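/- For a normed space $X$ over $\mathbf K\in\{\mathbf R,\mathbf C\}$ and $n\ge 1$ let $$c_n(X):=\inf\Big\{M\in\mathbf R:\ \prod_{j=1}^n\|f_j\|\le M\,\Big\|\prod_{j=1}^n f_j\Big\|\ \text{ for all } f_1,\dots,f_n\in X^*\Big\},\qquad \|p\|:=\sup_{\|x\|\le 1}|p(x)|,$$ be its $n$-th linear polarization constant, and let $c(X):=\lim_{n\to\infty}c_n(X)^{1/n}$ be its linear polarization constant, whenever the limit exists. For a subset $F$ of a metric space with metric $\rho$ let $$M_n(F):=\inf_{y_1,\dots,y_n\in F}\ \sup_{y\in F}\ \prod_{j=1}^n\rho(y,y_j)$$ be its $n$-th (metric) Chebyshev constant. Let $S^1\subset\mathbf R^2$ and $S^2\subset\mathbf R^3$ be the Euclidean unit spheres, with the metric $\rho(x,y)=\|x-y\|_2$ of the ambient space, and let $\ell_2^2(\mathbf K)$ denote $\mathbf K^2$ with the Euclidean norm. For the real space $\ell_2^2(\mathbf R)$ one has, for every $n\ge 1$, $$c_n(\ell_2^2(\mathbf R))=\frac{2^n}{M_n(S^1)}=2^{n-1},$$ and the limit $c(\ell_2^2(\mathbf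 R))$ exists and equals $2$. For the complex space $\ell_2^2(\mathbf C)$ one has, for every $n\ge 1$, $$c_n(\ell_2^2(\mathbf C))=\frac{2^n}{M_n(S^2)},$$ and the limit $c(\ell_2^2(\mathbf C))$ exists and equals $\sqrt e$. -/

import Mathlib

open Filter Topology

noncomputable section

/-- The supremum norm of `f` on the closed unit ball of `X`. -/
def unitBallNorm {𝕜 X : Type*} [NormedField 𝕜] [SeminormedAddCommGroup X] (f : X → 𝕜) : ℝ :=
  ⨆ x : Metric.closedBall (0 : X) 1, ‖f x‖

/-- The `n`-th linear polarization constant of `X`: the infimum of all `M` such that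
`‖f₁‖ ⋯ ‖fₙ‖ ≤ M ‖f₁ ⋯ fₙ‖` for all continuous linear functionals `f₁, …, fₙ` on `X`, where the
norm on the right is the supremum norm over the unit ball. -/
def polarizationConst (𝕜 X : Type*) [RCLike 𝕜] [NormedAddCommGroup X] [NormedSpace 𝕜 X]
    (n : ℕ) : ℝ :=
  sInf {M : ℝ | ∀ f : Fin n → StrongDual 𝕜 X,
    ∏ j, ‖f j‖ ≤ M * unitBallNorm (fun x : X => ∏ j, f j x)}

/-- `c` is the linear polarization constant of `X`: the limit of `cₙ(X) ^ (1 / n)` exists and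
equals `c`. -/
def HasLinearPolarizationConst (𝕜 X : Type*) [RCLike 𝕜] [NormedAddCommGroup X]
    [NormedSpace 𝕜 X] (c : ℝ) : Prop :=
  Tendsto (fun n : ℕ => polarizationConst 𝕜 X n ^ (1 / (n : ℝ))) atTop (𝓝 c)

/-- The `n`-th metric Chebyshev constant of a subset `F` of a metric space. -/
def metricChebyshevConst {X : Type*} [MetricSpace X] (F : Set X) (n : ℕ) : ℝ :=
  ⨅ y : Fin n → F, ⨆ z : F, ∏ j, dist (z : X) (y j : X)

end

/-!
Write `I n` for the infimum, over unit vectors `a₁, …, aₙ`, of the supremum over the unit sphere of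
`|⟪a₁, x⟫ ⋯ ⟪aₙ, x⟫|`. Functionals on a Hilbert space are inner products, so homogeneity gives
`cₙ = 1 / I n` as soon as `I n > 0` (`polarizationConst_eq_inv`). The Hopf map `h : S³ → S²` is
onto and satisfies `‖h x + h a‖ = 2 |⟪a, x⟫|`, and the angle-doubling map of the circle does the
same in the real plane; hence `Mₙ = 2ⁿ I n` (`metricChebyshevConst_eq`), which yields both formulas
`cₙ = 2ⁿ / Mₙ`.

On the circle `Mₙ = 2`: for `n`-th roots of unity the product of the distances is `|zⁿ - 1| ≤ 2`,
and for arbitrary nodes a monic polynomial with constant term of modulus one has modulus at least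
`2` somewhere on the circle (`exists_two_le_prod_norm_sub`).

On the complex plane `I n` is `exp (-n / 2)` up to a subexponential factor. For the lower bound, the
maximum principle on the torus `|x₀|² = 1 - s`, `|x₁|² = s` shows that the squared supremum is at
least `∏ⱼ max ((1 - bⱼ) (1 - s)) (bⱼ s)` with `bⱼ = |(aⱼ)₁|²`; the logarithm of each factor has
integral `-1` over `0 ≤ s ≤ 1` (`integral_log_max`). For the upper bound, take `m` rings
`b = k / m`, `0 ≤ k < m`, of `m` equally spaced points each. A ring contributes a difference of two
`m`-th powers, whose square is at most `4 max ((1 - b) (1 - s)) (b s) ^ m`, and the product of these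
maxima over the rings is at most `(m! / mᵐ)² eᵐ` because `tʲ / j! ≤ eᵗ` (`prod_range_max_le`).
With `m = ⌊√n⌋` and arbitrary further points this gives `I n ≤ (2 e² m)ᵐ exp (-n / 2)`.
-/

/-! ### Products of unit functionals on the unit sphere -/

theorem max_sq_sq {x y : ℝ} (hx : 0 ≤ x) (hy : 0 ≤ y) : max (x ^ 2) (y ^ 2) = max x y ^ 2 := by
  rcases le_total x y with h | h
  · rw [max_eq_right h, max_eq_right (by gcongr)]
  · rw [max_eq_left h, max_eq_left (by gcongr)]

section InnerProduct

variable (𝕜 : Type*) {E : Type*} [RCLike 𝕜] [NormedAddCommGroup E] [InnerProductSpace 𝕜 E]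

/-- The supremum over the unit sphere of `|⟪a₁, x⟫ ⋯ ⟪aₙ, x⟫|`, for unit vectors `a₁, …, aₙ`. -/
noncomputable def sphereProdSup {n : ℕ} (a : Fin n → Metric.sphere (0 : E) 1) : ℝ :=
  ⨆ x : Metric.sphere (0 : E) 1, ∏ j, ‖inner 𝕜 (a j : E) (x : E)‖

variable (E) in
/-- The least possible supremum over the unit sphere of a product of `n` unit functionals. -/
noncomputable def infSphereProdSup (n : ℕ) : ℝ :=
  ⨅ a : Fin n → Metric.sphere (0 : E) 1, sphereProdSup 𝕜 a

theorem norm_inner_sphere_le_one (a x : Metric.sphere (0 : E) 1) :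
    ‖inner 𝕜 (a : E) (x : E)‖ ≤ 1 := by
  simpa using norm_inner_le_norm (𝕜 := 𝕜) (a : E) (x : E)

theorem norm_sq_add_norm_sq_eq_one (x : Metric.sphere (0 : EuclideanSpace 𝕜 (Fin 2)) 1) :
    ‖(x : EuclideanSpace 𝕜 (Fin 2)) 0‖ ^ 2 + ‖(x : EuclideanSpace 𝕜 (Fin 2)) 1‖ ^ 2 = 1 := by
  have := EuclideanSpace.norm_sq_eq (x : EuclideanSpace 𝕜 (Fin 2))
  simpa [Fin.sum_univ_two] using this.symm

theorem prod_le_sphereProdSup {n : ℕ} (a : Fin n → Metric.sphere (0 : E) 1)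
    (x : Metric.sphere (0 : E) 1) :
    ∏ j, ‖inner 𝕜 (a j : E) (x : E)‖ ≤ sphereProdSup 𝕜 a := by
  refine le_ciSup (f := fun x : Metric.sphere (0 : E) 1 => ∏ j, ‖inner 𝕜 (a j : E) (x : E)‖)
    ⟨1, ?_⟩ x
  rintro _ ⟨z, rfl⟩
  exact Finset.prod_le_one (fun _ _ => norm_nonneg _)
    fun j _ => norm_inner_sphere_le_one 𝕜 (a j) z

theorem sphereProdSup_nonneg {n : ℕ} (a : Fin n → Metric.sphere (0 : E) 1) :
    0 ≤ sphereProdSup 𝕜 a :=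
  Real.iSup_nonneg fun _ => Finset.prod_nonneg fun _ _ => norm_nonneg _

theorem infSphereProdSup_le {n : ℕ} (a : Fin n → Metric.sphere (0 : E) 1) :
    infSphereProdSup 𝕜 E n ≤ sphereProdSup 𝕜 a :=
  ciInf_le ⟨0, by rintro _ ⟨b, rfl⟩; exact sphereProdSup_nonneg 𝕜 b⟩ a

/-- If `g` and `h` map the unit sphere onto `F` and the distance of `h x` and `g a` is
`2 |⟪a, x⟫|`, products of distances in `F` are rescaled products of functionals. -/
theorem metricChebyshevConst_eq {Y : Type*} [MetricSpace Y] {F : Set Y}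
    {g h : Metric.sphere (0 : E) 1 → F} (hg : g.Surjective) (hh : h.Surjective)
    (hd : ∀ a x, dist (h x : Y) (g a) = 2 * ‖inner 𝕜 (a : E) (x : E)‖) (n : ℕ) :
    metricChebyshevConst F n = 2 ^ n * infSphereProdSup 𝕜 E n := by
  have hg' : Function.Surjective fun (a : Fin n → Metric.sphere (0 : E) 1) j => g (a j) :=
    hg.comp_left
  rw [metricChebyshevConst, ← hg'.iInf_comp, infSphereProdSup,
    Real.mul_iInf_of_nonneg (by positivity)]
  refine iInf_congr fun a => ?_
  rw [← hh.iSup_comp, sphereProdSup, Real.mul_iSup_of_nonneg (by positivity)]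
  refine iSup_congr fun x => ?_
  simp [hd, Finset.prod_mul_distrib]

variable [Nontrivial E]

theorem exists_eq_smul_sphere (x : E) :
    ∃ u : Metric.sphere (0 : E) 1, x = (‖x‖ : 𝕜) • (u : E) := by
  let _ : NormedSpace ℝ E := NormedSpace.restrictScalars ℝ 𝕜 E
  by_cases hx : x = 0
  · obtain ⟨u, hu⟩ := (NormedSpace.sphere_nonempty (x := (0 : E)) (r := 1)).2 zero_le_one
    exact ⟨⟨u, hu⟩, by simp [hx]⟩
  · refine ⟨⟨(‖x‖⁻¹ : 𝕜) • x, ?_⟩, ?_⟩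
    · simp [norm_smul, hx]
    · have : (‖x‖ : 𝕜) ≠ 0 := by simpa using hx
      simp [smul_smul, this]

/-- Every functional is, up to its norm and a unimodular factor, the inner product with a unit
vector. -/
theorem exists_sphere_norm_apply_eq [CompleteSpace E] (f : StrongDual 𝕜 E) :
    ∃ a : Metric.sphere (0 : E) 1, ∀ x, ‖f x‖ = ‖f‖ * ‖inner 𝕜 (a : E) x‖ := by
  obtain ⟨a, ha⟩ := exists_eq_smul_sphere 𝕜 ((InnerProductSpace.toDual 𝕜 E).symm f)
  refine ⟨a, fun x => ?_⟩
  rw [← InnerProductSpace.toDual_symm_apply, ha, inner_smul_left]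
  simp

/-- By homogeneity the supremum over the ball is attained on the sphere, where the norms of the
functionals factor out. -/
theorem unitBallNorm_prod {n : ℕ} (f : Fin n → StrongDual 𝕜 E)
    (a : Fin n → Metric.sphere (0 : E) 1)
    (h : ∀ j x, ‖f j x‖ = ‖f j‖ * ‖inner 𝕜 (a j : E) x‖) :
    unitBallNorm (fun x : E => ∏ j, f j x) = (∏ j, ‖f j‖) * sphereProdSup 𝕜 a := by
  let _ : NormedSpace ℝ E := NormedSpace.restrictScalars ℝ 𝕜 E
  have hne : Nonempty (Metric.sphere (0 : E) 1) :=
    ((NormedSpace.sphere_nonempty (x := (0 : E)) (r := 1)).2 zero_le_one).to_subtype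
  have hp : 0 ≤ ∏ j, ‖f j‖ := Finset.prod_nonneg fun _ _ => norm_nonneg _
  have hle : ∀ x : Metric.closedBall (0 : E) 1,
      ‖∏ j, f j x‖ ≤ (∏ j, ‖f j‖) * sphereProdSup 𝕜 a := by
    rintro ⟨x, hx⟩
    obtain ⟨u, hu⟩ := exists_eq_smul_sphere 𝕜 x
    have hx1 : ‖x‖ ≤ 1 := by simpa using hx
    rw [norm_prod]
    simp only [h, Finset.prod_mul_distrib]
    refine mul_le_mul_of_nonneg_left
      (le_trans (Finset.prod_le_prod (fun _ _ => norm_nonneg _) fun j _ => ?_)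
        (prod_le_sphereProdSup 𝕜 a u)) hp
    rw [hu, inner_smul_right, norm_mul]
    simpa using mul_le_mul_of_nonneg_right hx1 (norm_nonneg (inner 𝕜 (a j : E) (u : E)))
  have : Nonempty (Metric.closedBall (0 : E) 1) := ⟨⟨0, by simp⟩⟩
  refine le_antisymm (ciSup_le hle) ?_
  rw [sphereProdSup, Real.mul_iSup_of_nonneg hp]
  refine ciSup_le fun x => ?_
  refine le_trans (le_of_eq ?_) (le_ciSup (f := fun x : Metric.closedBall (0 : E) 1 =>
    ‖∏ j, f j x‖) ⟨_, by rintro _ ⟨z, rfl⟩; exact hle z⟩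
      ⟨x, Metric.sphere_subset_closedBall x.2⟩)
  simp only [norm_prod, h, Finset.prod_mul_distrib]

/-- The admissible constants form the half-line `[(infSphereProdSup 𝕜 E n)⁻¹, ∞)`. -/
theorem polarizationConst_eq_inv [CompleteSpace E] (n : ℕ) (hpos : 0 < infSphereProdSup 𝕜 E n) :
    polarizationConst 𝕜 E n = (infSphereProdSup 𝕜 E n)⁻¹ := by
  have hne : Nonempty (Metric.sphere (0 : E) 1) := ⟨(exists_eq_smul_sphere 𝕜 (0 : E)).choose⟩
  have key : {M : ℝ | ∀ f : Fin n → StrongDual 𝕜 E,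
      ∏ j, ‖f j‖ ≤ M * unitBallNorm (fun x : E => ∏ j, f j x)}
      = Set.Ici (infSphereProdSup 𝕜 E n)⁻¹ := by
    ext M
    simp only [Set.mem_ofPred_eq, Set.mem_Ici]
    constructor
    · intro hM
      have h1 : ∀ a : Fin n → Metric.sphere (0 : E) 1, 1 ≤ M * sphereProdSup 𝕜 a := by
        intro a
        have := hM fun j => InnerProductSpace.toDual 𝕜 E (a j)
        rw [unitBallNorm_prod 𝕜 _ a (by simp)] at this
        simpa using this
      have hM0 : 0 < M := by
        obtain ⟨a⟩ : Nonempty (Fin n → Metric.sphere (0 : E) 1) := inferInstance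
        have := h1 a
        by_contra hM0
        nlinarith [sphereProdSup_nonneg 𝕜 a]
      rw [inv_le_comm₀ hpos hM0]
      refine le_ciInf fun a => ?_
      rw [inv_le_iff_one_le_mul₀' hM0]
      exact h1 a
    · intro hM f
      choose a ha using fun j => exists_sphere_norm_apply_eq 𝕜 (f j)
      rw [unitBallNorm_prod 𝕜 f a ha, mul_left_comm]
      refine le_mul_of_one_le_right (Finset.prod_nonneg fun _ _ => norm_nonneg _) ?_
      calc (1 : ℝ) = (infSphereProdSup 𝕜 E n)⁻¹ * infSphereProdSup 𝕜 E n :=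
            (inv_mul_cancel₀ hpos.ne').symm
        _ ≤ M * sphereProdSup 𝕜 a :=
            mul_le_mul hM (infSphereProdSup_le 𝕜 a) hpos.le ((inv_pos.2 hpos).le.trans hM)
  rw [polarizationConst, key, csInf_Ici]

theorem polarizationConst_eq_div [CompleteSpace E] {Y : Type*} [MetricSpace Y] {F : Set Y}
    {g h : Metric.sphere (0 : E) 1 → F} (hg : g.Surjective) (hh : h.Surjective)
    (hd : ∀ a x, dist (h x : Y) (g a) = 2 * ‖inner 𝕜 (a : E) (x : E)‖) (n : ℕ)
    (hpos : 0 < infSphereProdSup 𝕜 E n) :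
    polarizationConst 𝕜 E n = 2 ^ n / metricChebyshevConst F n := by
  rw [metricChebyshevConst_eq 𝕜 hg hh hd, polarizationConst_eq_inv 𝕜 n hpos]
  field_simp

end InnerProduct

/-! ### The lower bound on the complex Euclidean plane -/

/-- Maximum modulus principle: reflecting those factors whose zero lies inside the unit disc does
not change the absolute value on the unit circle, and the value at `0` becomes the product of the
larger coefficients. -/
theorem prod_max_norm_le_of_forall_norm_eq_one {ι : Type*} (s : Finset ι) (c d : ι → ℂ) {C : ℝ}
    (hC : ∀ z : ℂ, ‖z‖ = 1 → ∏ j ∈ s, ‖c j + z * d j‖ ≤ C) :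
    ∏ j ∈ s, max ‖c j‖ ‖d j‖ ≤ C := by
  let q : ι → ℂ → ℂ := fun j z =>
    if ‖d j‖ ≤ ‖c j‖ then c j + z * d j else star (d j) + z * star (c j)
  have hq0 : ∀ j, ‖q j 0‖ = max ‖c j‖ ‖d j‖ := by
    intro j
    by_cases h : ‖d j‖ ≤ ‖c j‖
    · simp [q, h]
    · simp [q, h, (not_le.1 h).le]
  have hq1 : ∀ j (z : ℂ), ‖z‖ = 1 → ‖q j z‖ = ‖c j + z * d j‖ := by
    intro j z hz
    by_cases h : ‖d j‖ ≤ ‖c j‖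
    · simp [q, h]
    · -- On the unit circle the reflected factor is `z` times the conjugate of the original one.
      have hzz : z * star z = 1 := by
        simpa [hz] using Complex.mul_conj' z
      have : star (d j) + z * star (c j) = z * star (c j + z * d j) := by
        simp only [star_add, star_mul']
        linear_combination -(star (d j)) * hzz
      simp only [q, h, if_false, this, norm_mul, norm_star, hz, one_mul]
  have hqd : Differentiable ℂ fun z => ∏ j ∈ s, q j z := by
    refine Differentiable.fun_finsetProd fun j _ => ?_
    by_cases h : ‖d j‖ ≤ ‖c j‖ <;> simp only [q, h, if_true, if_false] <;> fun_prop
  have := Complex.norm_le_of_forall_mem_frontier_norm_le (F := ℂ) (C := C)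
    (f := fun z => ∏ j ∈ s, q j z) (U := Metric.ball (0 : ℂ) 1) Metric.isBounded_ball
    hqd.diffContOnCl (fun z hz => by
      rw [frontier_ball (0 : ℂ) one_ne_zero, mem_sphere_zero_iff_norm] at hz
      simpa only [norm_prod, hq1 _ z hz] using hC z hz)
    (z := 0) (subset_closure (Metric.mem_ball_self one_pos))
  simpa only [norm_prod, hq0] using this

open MeasureTheory in
/-- The two branches of the maximum cross at `s = 1 - b`. -/
theorem integral_log_max {b : ℝ} (hb0 : 0 ≤ b) (hb1 : b ≤ 1) :
    IntervalIntegrable (fun s => Real.log (max ((1 - b) * (1 - s)) (b * s))) volume 0 1 ∧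
      ∫ s in (0 : ℝ)..1, Real.log (max ((1 - b) * (1 - s)) (b * s)) = -1 := by
  set g : ℝ → ℝ := fun s => Real.log (max ((1 - b) * (1 - s)) (b * s)) with hg
  have e1 : Set.EqOn (fun s => Real.log (1 - b) + Real.log (1 - s)) g (Set.uIoo 0 (1 - b)) := by
    intro s hs
    rw [Set.uIoo_of_le (by linarith)] at hs
    have : b * s ≤ (1 - b) * (1 - s) := by nlinarith [hs.2]
    simp only [hg, max_eq_left this]
    rw [Real.log_mul (by linarith [hs.1, hs.2]) (by linarith [hs.1, hs.2])]
  have e2 : Set.EqOn (fun s => Real.log b + Real.log s) g (Set.uIoo (1 - b) 1) := by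
    intro s hs
    rw [Set.uIoo_of_le (by linarith)] at hs
    have : (1 - b) * (1 - s) ≤ b * s := by nlinarith [hs.1]
    simp only [hg, max_eq_right this]
    rw [Real.log_mul (by linarith [hs.1, hs.2]) (by linarith [hs.1, hs.2])]
  have j1 : IntervalIntegrable (fun s => Real.log (1 - s)) volume 0 (1 - b) := by
    simpa using (intervalIntegral.intervalIntegrable_log' (a := 1) (b := b)).comp_sub_left 1
  have j2 : IntervalIntegrable Real.log volume (1 - b) 1 :=
    intervalIntegral.intervalIntegrable_log'
  have i1 : IntervalIntegrable g volume 0 (1 - b) :=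
    (intervalIntegrable_const.add j1).congr_uIoo e1
  have i2 : IntervalIntegrable g volume (1 - b) 1 :=
    (intervalIntegrable_const.add j2).congr_uIoo e2
  refine ⟨i1.trans i2, ?_⟩
  rw [← intervalIntegral.integral_add_adjacent_intervals i1 i2,
    ← intervalIntegral.integral_congr_uIoo e1, ← intervalIntegral.integral_congr_uIoo e2,
    intervalIntegral.integral_add intervalIntegrable_const j1,
    intervalIntegral.integral_add intervalIntegrable_const j2,
    intervalIntegral.integral_comp_sub_left Real.log 1]
  simp only [intervalIntegral.integral_const, integral_log, smul_eq_mul, sub_sub_cancel, sub_zero,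
    Real.log_one]
  ring

/-- The maximum principle on the torus `|x₀|² = 1 - s`, `|x₁|² = s`. -/
theorem prod_max_le_sphereProdSup_sq {n : ℕ}
    (a : Fin n → Metric.sphere (0 : EuclideanSpace ℂ (Fin 2)) 1) {s : ℝ} (hs0 : 0 ≤ s)
    (hs1 : s ≤ 1) :
    ∏ j, max ((1 - ‖(a j : EuclideanSpace ℂ (Fin 2)) 1‖ ^ 2) * (1 - s))
      (‖(a j : EuclideanSpace ℂ (Fin 2)) 1‖ ^ 2 * s) ≤ sphereProdSup ℂ a ^ 2 := by
  have key : ∏ j, max ‖star ((a j : EuclideanSpace ℂ (Fin 2)) 0) * (√(1 - s) : ℂ)‖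
      ‖star ((a j : EuclideanSpace ℂ (Fin 2)) 1) * (√s : ℂ)‖ ≤ sphereProdSup ℂ a := by
    refine prod_max_norm_le_of_forall_norm_eq_one _ _ _ fun z hz => ?_
    have hx : !₂[(√(1 - s) : ℂ), z * (√s : ℂ)] ∈
        Metric.sphere (0 : EuclideanSpace ℂ (Fin 2)) 1 := by
      rw [mem_sphere_zero_iff_norm, EuclideanSpace.norm_eq, Real.sqrt_eq_one]
      simp [Fin.sum_univ_two, hz, Real.sq_sqrt, hs0, hs1]
    refine le_trans (le_of_eq ?_) (prod_le_sphereProdSup ℂ a ⟨_, hx⟩)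
    refine Finset.prod_congr rfl fun j _ => ?_
    congr 1
    simp [PiLp.inner_apply, Fin.sum_univ_two]
    ring
  calc _ = (∏ j, max ‖star ((a j : EuclideanSpace ℂ (Fin 2)) 0) * (√(1 - s) : ℂ)‖
      ‖star ((a j : EuclideanSpace ℂ (Fin 2)) 1) * (√s : ℂ)‖) ^ 2 := by
        rw [← Finset.prod_pow]
        refine Finset.prod_congr rfl fun j _ => ?_
        have h0 : ‖(a j : EuclideanSpace ℂ (Fin 2)) 0‖ ^ 2 =
            1 - ‖(a j : EuclideanSpace ℂ (Fin 2)) 1‖ ^ 2 :=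
          eq_sub_of_add_eq (norm_sq_add_norm_sq_eq_one ℂ (a j))
        rw [← max_sq_sq (norm_nonneg _) (norm_nonneg _)]
        simp only [norm_mul, norm_star, mul_pow, Complex.norm_real, Real.norm_eq_abs, sq_abs,
          Real.sq_sqrt hs0, Real.sq_sqrt (sub_nonneg.2 hs1), h0]
    _ ≤ _ := pow_le_pow_left₀ (Finset.prod_nonneg fun _ _ => by positivity) key 2

/-- Averaging the logarithm over the tori `|x₁|² = s`, `0 < s < 1`. -/
theorem exp_neg_half_le_sphereProdSup {n : ℕ}
    (a : Fin n → Metric.sphere (0 : EuclideanSpace ℂ (Fin 2)) 1) :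
    Real.exp (-(n / 2)) ≤ sphereProdSup ℂ a := by
  set b : Fin n → ℝ := fun j => ‖(a j : EuclideanSpace ℂ (Fin 2)) 1‖ ^ 2 with hb
  have hb0 : ∀ j, 0 ≤ b j := fun j => by positivity
  have hb1 : ∀ j, b j ≤ 1 := fun j => by
    have := norm_sq_add_norm_sq_eq_one ℂ (a j)
    simp only [hb]
    nlinarith [sq_nonneg ‖(a j : EuclideanSpace ℂ (Fin 2)) 0‖]
  have hpos : ∀ s ∈ Set.Ioo (0 : ℝ) 1, ∀ j, 0 < max ((1 - b j) * (1 - s)) (b j * s) := by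
    intro s hs j
    rcases (hb0 j).eq_or_lt with h | h
    · exact lt_max_of_lt_left (by rw [← h]; linarith [hs.2])
    · exact lt_max_of_lt_right (mul_pos h hs.1)
  have hP : 0 < sphereProdSup ℂ a := by
    have h1 := prod_max_le_sphereProdSup_sq a (s := 1 / 2) (by norm_num) (by norm_num)
    have h2 := Finset.prod_pos fun j (_ : j ∈ Finset.univ) =>
      hpos (1 / 2) ⟨by norm_num, by norm_num⟩ j
    exact (sphereProdSup_nonneg ℂ a).lt_of_ne' fun h => by
      rw [h] at h1
      norm_num at h1 h2
      linarith
  have hint : ∫ s in (0 : ℝ)..1, ∑ j, Real.log (max ((1 - b j) * (1 - s)) (b j * s)) = -n := by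
    rw [intervalIntegral.integral_finsetSum fun j _ => (integral_log_max (hb0 j) (hb1 j)).1]
    simp [fun j => (integral_log_max (hb0 j) (hb1 j)).2]
  have hle : ∫ s in (0 : ℝ)..1, ∑ j, Real.log (max ((1 - b j) * (1 - s)) (b j * s)) ≤
      ∫ _ in (0 : ℝ)..1, 2 * Real.log (sphereProdSup ℂ a) := by
    refine intervalIntegral.integral_mono_on_of_le_Ioo zero_le_one
      (by simpa only [Finset.sum_fn] using
        IntervalIntegrable.sum _ fun j _ => (integral_log_max (hb0 j) (hb1 j)).1)
      intervalIntegrable_const fun s hs => ?_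
    rw [← Real.log_prod fun j _ => (hpos s hs j).ne', ← Nat.cast_ofNat, ← Real.log_pow]
    exact Real.log_le_log (Finset.prod_pos fun j _ => hpos s hs j)
      (prod_max_le_sphereProdSup_sq a hs.1.le hs.2.le)
  rw [hint] at hle
  simp only [intervalIntegral.integral_const, sub_zero, one_smul] at hle
  rw [← Real.le_log_iff_exp_le hP]
  linarith

theorem exp_neg_half_le_infSphereProdSup (n : ℕ) :
    Real.exp (-(n / 2)) ≤ infSphereProdSup ℂ (EuclideanSpace ℂ (Fin 2)) n := by
  have : Nonempty (Metric.sphere (0 : EuclideanSpace ℂ (Fin 2)) 1) :=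
    ⟨(exists_eq_smul_sphere ℂ (0 : EuclideanSpace ℂ (Fin 2))).choose⟩
  exact le_ciInf exp_neg_half_le_sphereProdSup

/-! ### Concentric rings of points on the two-dimensional sphere -/

/-- The maximum of a decreasing and an increasing sequence switches branch at most once. -/
theorem prod_range_max_eq {A B : ℕ → ℝ} (hA : Antitone A) (hB : Monotone B) (m : ℕ) :
    ∃ j ≤ m, ∏ k ∈ Finset.range m, max (A k) (B k) =
      (∏ k ∈ Finset.range j, A k) * ∏ k ∈ Finset.Ico j m, B k := by
  induction m with
  | zero => exact ⟨0, le_rfl, by simp⟩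
  | succ m ih =>
    rcases le_total (A m) (B m) with h | h
    · obtain ⟨j, hj, e⟩ := ih
      refine ⟨j, hj.trans m.le_succ, ?_⟩
      rw [Finset.prod_range_succ, e, max_eq_right h, Finset.prod_Ico_succ_top hj, mul_assoc]
    · refine ⟨m + 1, le_rfl, ?_⟩
      rw [Finset.Ico_self, Finset.prod_empty, mul_one]
      refine Finset.prod_congr rfl fun k hk => max_eq_left ?_
      have hk : k ≤ m := Nat.lt_succ_iff.1 (Finset.mem_range.1 hk)
      exact (hB hk).trans (h.trans (hA hk))

theorem factorial_le_exp_mul (m : ℕ) (hm : 1 ≤ m) :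
    (m.factorial : ℝ) ≤ Real.exp 1 * m * m ^ m * Real.exp (-m) := by
  induction m, hm using Nat.le_induction with
  | base => simp [← Real.exp_add]
  | succ m hm ih =>
    have hm0 : (0 : ℝ) < m := by exact_mod_cast hm
    -- `e ≤ (1 + 1 / m) ^ (m + 1)`
    have h1 : (m : ℝ) ^ (m + 1) ≤ (m + 1) ^ (m + 1) * Real.exp (-1) := by
      have h2 : (m : ℝ) / (m + 1) ≤ Real.exp (-(1 / (m + 1))) := by
        have := Real.add_one_le_exp (-(1 / ((m : ℝ) + 1)))
        refine le_trans (le_of_eq ?_) this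
        field_simp
        ring
      have h3 := pow_le_pow_left₀ (by positivity) h2 (m + 1)
      rw [← Real.exp_nat_mul, div_pow, div_le_iff₀ (by positivity)] at h3
      refine h3.trans (le_of_eq ?_)
      rw [mul_comm]
      congr 2
      push_cast
      field_simp
    calc ((m + 1).factorial : ℝ) = (m + 1) * m.factorial := by
          rw [Nat.factorial_succ]; push_cast; ring
      _ ≤ (m + 1) * (Real.exp 1 * m * m ^ m * Real.exp (-m)) := by gcongr
      _ = (m + 1) * Real.exp 1 * Real.exp (-m) * m ^ (m + 1) := by ring
      _ ≤ (m + 1) * Real.exp 1 * Real.exp (-m) * ((m + 1) ^ (m + 1) * Real.exp (-1)) := by gcongr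
      _ = _ := by
          push_cast
          rw [neg_add, Real.exp_add]
          ring

/-- Discrete counterpart of `∫ log (max ((1 - b) (1 - s)) (b s)) db = -1`, with the nodes
`b = k / m`. -/
theorem prod_range_max_le (m : ℕ) (hm : 1 ≤ m) {s : ℝ} (hs0 : 0 ≤ s) (hs1 : s ≤ 1) :
    ∏ k ∈ Finset.range m, max ((1 - k / m) * (1 - s)) (k / m * s) ≤
      (Real.exp 1 * m) ^ 2 * Real.exp (-m) := by
  have hm0 : (0 : ℝ) < m := by exact_mod_cast hm
  have h1s : 0 ≤ 1 - s := by linarith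
  -- The factors `k / m` are increased to `(k + 1) / m`, which leaves only factorials.
  have hA : Antitone fun k : ℕ => (1 - k / m) * (1 - s) := by
    intro k l hkl
    have : (k : ℝ) ≤ l := by exact_mod_cast hkl
    dsimp only
    gcongr
  have hB : Monotone fun k : ℕ => ((k + 1 : ℕ) : ℝ) / m * s := by
    intro k l hkl
    dsimp only
    gcongr
  obtain ⟨j, hj, e⟩ := prod_range_max_eq hA hB m
  have hA' : ∏ k ∈ Finset.range j, (1 - (k : ℝ) / m) * (1 - s) =
      m.factorial / (m - j).factorial * (1 - s) ^ j / m ^ j := by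
    have h : (m.descFactorial j : ℝ) = m.factorial / (m - j).factorial := by
      rw [eq_div_iff (by positivity), mul_comm]
      exact_mod_cast Nat.factorial_mul_descFactorial hj
    rw [← h, Nat.descFactorial_eq_prod_range, Finset.prod_mul_distrib, Finset.prod_const,
      Finset.card_range, mul_div_right_comm, Nat.cast_prod]
    congr 1
    rw [eq_div_iff (by positivity)]
    nth_rw 2 [← Finset.card_range j]
    rw [← Finset.prod_const, ← Finset.prod_mul_distrib]
    refine Finset.prod_congr rfl fun k hk => ?_
    rw [Nat.cast_sub ((Finset.mem_range.1 hk).le.trans hj)]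
    field_simp
  have hB' : ∏ k ∈ Finset.Ico j m, ((k + 1 : ℕ) : ℝ) / m * s =
      m.factorial / j.factorial * s ^ (m - j) / m ^ (m - j) := by
    rw [Finset.prod_mul_distrib, Finset.prod_div_distrib, Finset.prod_const, Finset.prod_const,
      Nat.card_Ico, mul_div_right_comm]
    congr 2
    rw [eq_div_iff (by positivity), mul_comm, ← Finset.prod_range_add_one_eq_factorial,
      ← Finset.prod_range_add_one_eq_factorial, Nat.cast_prod, Nat.cast_prod,
      Finset.prod_range_mul_prod_Ico _ hj]
  have hf := factorial_le_exp_mul m hm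
  calc _ ≤ ∏ k ∈ Finset.range m,
          max ((1 - (k : ℝ) / m) * (1 - s)) (((k + 1 : ℕ) : ℝ) / m * s) := by
        refine Finset.prod_le_prod (fun k _ => le_max_of_le_right (by positivity)) fun k _ => ?_
        gcongr
        exact k.le_succ
    _ = (m.factorial / m ^ m) ^ 2 *
        ((m * (1 - s)) ^ j / j.factorial * ((m * s) ^ (m - j) / (m - j).factorial)) := by
        rw [e, hA', hB']
        obtain ⟨i, rfl⟩ := Nat.exists_eq_add_of_le hj
        rw [Nat.add_sub_cancel_left, pow_add, mul_pow, mul_pow]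
        field_simp
    _ ≤ (m.factorial / m ^ m) ^ 2 * (Real.exp (m * (1 - s)) * Real.exp (m * s)) := by
        gcongr
        · exact Real.pow_div_factorial_le_exp _ (by positivity) j
        · exact Real.pow_div_factorial_le_exp _ (by positivity) (m - j)
    _ = (m.factorial / m ^ m) ^ 2 * Real.exp m := by
        rw [← Real.exp_add]; congr 2; ring
    _ ≤ (Real.exp 1 * m * Real.exp (-m)) ^ 2 * Real.exp m := by
        gcongr
        rw [div_le_iff₀ (by positivity)]
        linarith
    _ = _ := by
        have : Real.exp (-m) * Real.exp m = 1 := by rw [← Real.exp_add]; simp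
        linear_combination (Real.exp 1 * m) ^ 2 * Real.exp (-m) * this

/-- `m` rings, at the heights `|a₁|² = k / m`, of `m` equally spaced points each. -/
theorem exists_rings (m : ℕ) (hm : 1 ≤ m) :
    ∃ a : Fin (m * m) → Metric.sphere (0 : EuclideanSpace ℂ (Fin 2)) 1,
      ∀ x : Metric.sphere (0 : EuclideanSpace ℂ (Fin 2)) 1,
        ∏ j, ‖inner ℂ (a j : EuclideanSpace ℂ (Fin 2)) (x : EuclideanSpace ℂ (Fin 2))‖ ≤
          (2 * Real.exp 1 * m) ^ m * Real.exp (-(m * m / 2)) := by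
  have hm0 : (0 : ℝ) < m := by exact_mod_cast hm
  have hprim := Complex.isPrimitiveRoot_exp m (by omega)
  let ι := Fin m × Polynomial.nthRootsFinset m (1 : ℂ)
  let v : ι → EuclideanSpace ℂ (Fin 2) := fun p =>
    !₂[(√(1 - (p.1 : ℕ) / m) : ℂ), -(star (p.2 : ℂ)) * (√((p.1 : ℕ) / m) : ℂ)]
  have hkm : ∀ k : Fin m, ((k : ℕ) : ℝ) / m ≤ 1 := fun k => by
    rw [div_le_one hm0]; exact_mod_cast k.2.le
  have hω : ∀ ω : Polynomial.nthRootsFinset m (1 : ℂ), ‖(ω : ℂ)‖ = 1 := fun ω =>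
    Complex.norm_eq_one_of_pow_eq_one ((Polynomial.mem_nthRootsFinset hm 1).1 ω.2) (by omega)
  have hv : ∀ p, v p ∈ Metric.sphere (0 : EuclideanSpace ℂ (Fin 2)) 1 := fun p => by
    rw [mem_sphere_zero_iff_norm, EuclideanSpace.norm_eq, Real.sqrt_eq_one]
    have h0 : (0 : ℝ) ≤ ((p.1 : ℕ) : ℝ) / m := by positivity
    have h1 := hkm p.1
    simp only [v]
    generalize ((p.1 : ℕ) : ℝ) / m = b at h0 h1 ⊢
    simp [Fin.sum_univ_two, hω, Real.sq_sqrt, h0, h1]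
  have hcard : Fintype.card ι = m * m := by
    simp [ι, hprim.card_nthRootsFinset]
  let e : Fin (m * m) ≃ ι := (Fintype.equivFinOfCardEq hcard).symm
  refine ⟨fun j => ⟨v (e j), hv _⟩, fun x => ?_⟩
  set x0 := (x : EuclideanSpace ℂ (Fin 2)) 0
  set x1 := (x : EuclideanSpace ℂ (Fin 2)) 1
  have hx : ‖x0‖ ^ 2 + ‖x1‖ ^ 2 = 1 := norm_sq_add_norm_sq_eq_one ℂ x
  -- The factors of the `k`-th ring multiply to `|A ^ m - B ^ m|`.
  have hring : ∀ k : Fin m, (∏ ω : Polynomial.nthRootsFinset m (1 : ℂ),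
      ‖inner ℂ (v (k, ω)) (x : EuclideanSpace ℂ (Fin 2))‖) ^ 2 ≤
        4 * (max ((1 - ((k : ℕ) : ℝ) / m) * (1 - ‖x1‖ ^ 2))
          (((k : ℕ) : ℝ) / m * ‖x1‖ ^ 2)) ^ m := by
    intro k
    set A : ℂ := (√(1 - (k : ℕ) / m) : ℂ) * x0 with hA
    set B : ℂ := (√((k : ℕ) / m) : ℂ) * x1 with hB
    have hA2 : ‖A‖ ^ 2 = (1 - ((k : ℕ) : ℝ) / m) * (1 - ‖x1‖ ^ 2) := by
      rw [hA, norm_mul, mul_pow, ← hx, add_sub_cancel_right, Complex.norm_real, Real.norm_eq_abs,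
        sq_abs, Real.sq_sqrt (by linarith [hkm k])]
    have hB2 : ‖B‖ ^ 2 = ((k : ℕ) : ℝ) / m * ‖x1‖ ^ 2 := by
      rw [hB, norm_mul, mul_pow, Complex.norm_real, Real.norm_eq_abs,
        sq_abs, Real.sq_sqrt (by positivity)]
    have hprod : ∏ ω : Polynomial.nthRootsFinset m (1 : ℂ),
        ‖inner ℂ (v (k, ω)) (x : EuclideanSpace ℂ (Fin 2))‖ = ‖A ^ m - B ^ m‖ := by
      rw [hprim.pow_sub_pow_eq_prod_sub_mul A B hm, norm_prod,
        ← Finset.prod_coe_sort (Polynomial.nthRootsFinset m (1 : ℂ)) fun ω => ‖A - ω * B‖]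
      refine Finset.prod_congr rfl fun ω _ => ?_
      congr 1
      simp [v, PiLp.inner_apply, Fin.sum_univ_two, A, B, x0, x1]
      ring
    rw [hprod, ← hA2, ← hB2]
    have h1 : ‖A ^ m - B ^ m‖ ≤ 2 * (max ‖A‖ ‖B‖) ^ m := by
      have h2 := norm_sub_le (A ^ m) (B ^ m)
      rw [norm_pow, norm_pow] at h2
      have h3 := pow_le_pow_left₀ (norm_nonneg A) (le_max_left ‖A‖ ‖B‖) m
      have h4 := pow_le_pow_left₀ (norm_nonneg B) (le_max_right ‖A‖ ‖B‖) m
      linarith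
    calc ‖A ^ m - B ^ m‖ ^ 2 ≤ (2 * (max ‖A‖ ‖B‖) ^ m) ^ 2 := by gcongr
      _ = _ := by rw [max_sq_sq (norm_nonneg _) (norm_nonneg _)]; ring
  have hs1 : ‖x1‖ ^ 2 ≤ 1 := by nlinarith [sq_nonneg ‖x0‖]
  refine le_of_sq_le_sq ?_ (by positivity)
  calc _ = (∏ p : ι, ‖inner ℂ (v p) (x : EuclideanSpace ℂ (Fin 2))‖) ^ 2 := by
        rw [← e.prod_comp]
    _ = ∏ k : Fin m, (∏ ω : Polynomial.nthRootsFinset m (1 : ℂ),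
          ‖inner ℂ (v (k, ω)) (x : EuclideanSpace ℂ (Fin 2))‖) ^ 2 := by
        rw [Fintype.prod_prod_type, Finset.prod_pow]
    _ ≤ ∏ k : Fin m, 4 * (max ((1 - ((k : ℕ) : ℝ) / m) * (1 - ‖x1‖ ^ 2))
          (((k : ℕ) : ℝ) / m * ‖x1‖ ^ 2)) ^ m :=
        Finset.prod_le_prod (fun _ _ => by positivity) fun k _ => hring k
    _ = 4 ^ m * (∏ k ∈ Finset.range m, max ((1 - (k : ℝ) / m) * (1 - ‖x1‖ ^ 2))
          ((k : ℝ) / m * ‖x1‖ ^ 2)) ^ m := by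
        rw [Finset.prod_mul_distrib, Finset.prod_pow, Finset.prod_const, Finset.card_fin,
          ← Fin.prod_univ_eq_prod_range (fun k : ℕ => max ((1 - (k : ℝ) / m) * (1 - ‖x1‖ ^ 2))
          ((k : ℝ) / m * ‖x1‖ ^ 2))]
    _ ≤ 4 ^ m * ((Real.exp 1 * m) ^ 2 * Real.exp (-m)) ^ m := by
        gcongr
        exact prod_range_max_le m hm (by positivity) hs1
    _ = _ := by
        have h4 : (4 : ℝ) ^ m = (2 ^ m) ^ 2 := by rw [← pow_mul, mul_comm, pow_mul]; norm_num
        have h5 : Real.exp (-m) ^ m = Real.exp (-(m * m / 2)) ^ 2 := by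
          rw [← Real.exp_nat_mul, ← Real.exp_nat_mul]
          push_cast
          ring_nf
        rw [mul_pow _ (Real.exp (-m)), h4, h5]
        ring

/-- Further functionals of norm one do not increase the product. -/
theorem infSphereProdSup_le_exp (n m : ℕ) (hm : 1 ≤ m) (h1 : m * m ≤ n) (h2 : n ≤ m * m + 2 * m) :
    infSphereProdSup ℂ (EuclideanSpace ℂ (Fin 2)) n ≤
      (2 * Real.exp 2 * m) ^ m * Real.exp (-(n / 2)) := by
  obtain ⟨a, ha⟩ := exists_rings m hm
  obtain ⟨r, rfl⟩ := Nat.exists_eq_add_of_le h1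
  obtain ⟨u, -⟩ := exists_eq_smul_sphere ℂ (0 : EuclideanSpace ℂ (Fin 2))
  have : Nonempty (Metric.sphere (0 : EuclideanSpace ℂ (Fin 2)) 1) := ⟨u⟩
  refine (infSphereProdSup_le ℂ (Fin.append a fun _ => u)).trans (ciSup_le fun x => ?_)
  have hr : (r : ℝ) ≤ 2 * m := by exact_mod_cast (by omega : r ≤ 2 * m)
  rw [Fin.prod_univ_add]
  simp only [Fin.append_left, Fin.append_right]
  calc _ ≤ (2 * Real.exp 1 * m) ^ m * Real.exp (-(m * m / 2)) * 1 :=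
        mul_le_mul (ha x) (Finset.prod_le_one (fun _ _ => norm_nonneg _)
          fun _ _ => norm_inner_sphere_le_one ℂ u x)
          (Finset.prod_nonneg fun _ _ => norm_nonneg _) (by positivity)
    _ ≤ (2 * Real.exp 1 * m) ^ m * (Real.exp m * Real.exp (-((m * m + r : ℕ) / 2))) := by
        rw [mul_one, ← Real.exp_add]
        gcongr
        push_cast
        linarith
    _ = _ := by
        have : Real.exp 2 = Real.exp 1 * Real.exp 1 := by rw [← Real.exp_add]; norm_num
        have h3 : Real.exp m = Real.exp 1 ^ m := by rw [← Real.exp_nat_mul]; simp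
        rw [this, h3]
        ring

/-! ### The Hopf map and its real analogue -/

/-- The Hopf map from the unit sphere of `ℂ²` onto the two-dimensional sphere. -/
noncomputable def hopfMap (x : Metric.sphere (0 : EuclideanSpace ℂ (Fin 2)) 1) :
    Metric.sphere (0 : EuclideanSpace ℝ (Fin 3)) 1 :=
  ⟨!₂[‖(x : EuclideanSpace ℂ (Fin 2)) 0‖ ^ 2 - ‖(x : EuclideanSpace ℂ (Fin 2)) 1‖ ^ 2,
      2 * ((x : EuclideanSpace ℂ (Fin 2)) 0 * star ((x : EuclideanSpace ℂ (Fin 2)) 1)).re,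
      2 * ((x : EuclideanSpace ℂ (Fin 2)) 0 * star ((x : EuclideanSpace ℂ (Fin 2)) 1)).im], by
    have h := norm_sq_add_norm_sq_eq_one ℂ x
    rw [mem_sphere_zero_iff_norm, EuclideanSpace.norm_eq, Real.sqrt_eq_one]
    simp only [← Complex.normSq_eq_norm_sq, Complex.normSq_apply] at h
    simp only [Fin.sum_univ_three, Real.norm_eq_abs, sq_abs, ← Complex.normSq_eq_norm_sq,
      Complex.normSq_apply, Complex.mul_re, Complex.mul_im, Complex.star_def, Complex.conj_re,
      Complex.conj_im, Matrix.cons_val]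
    linear_combination congrArg (· ^ 2) h⟩

/-- The angle-doubling map of the circle. -/
noncomputable def doublingMap (x : Metric.sphere (0 : EuclideanSpace ℝ (Fin 2)) 1) :
    Metric.sphere (0 : EuclideanSpace ℝ (Fin 2)) 1 :=
  ⟨!₂[(x : EuclideanSpace ℝ (Fin 2)) 0 ^ 2 - (x : EuclideanSpace ℝ (Fin 2)) 1 ^ 2,
      2 * ((x : EuclideanSpace ℝ (Fin 2)) 0 * (x : EuclideanSpace ℝ (Fin 2)) 1)], by
    have h := norm_sq_add_norm_sq_eq_one ℝ x
    simp only [Real.norm_eq_abs, sq_abs] at h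
    rw [mem_sphere_zero_iff_norm, EuclideanSpace.norm_eq, Real.sqrt_eq_one]
    simp only [Fin.sum_univ_two, Real.norm_eq_abs, sq_abs, Matrix.cons_val]
    linear_combination congrArg (· ^ 2) h⟩

theorem hopfMap_surjective : Function.Surjective hopfMap := by
  rintro ⟨y, hy⟩
  have h := EuclideanSpace.norm_sq_eq y
  rw [mem_sphere_zero_iff_norm.1 hy] at h
  simp only [Fin.sum_univ_three, Real.norm_eq_abs, sq_abs, one_pow] at h
  have hy0 : -1 ≤ y 0 := by nlinarith [sq_nonneg (y 1), sq_nonneg (y 2)]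
  -- Away from the pole a preimage with real positive first coordinate `t` exists.
  rcases hy0.eq_or_lt with h0 | h0
  · have h1 : y 1 = 0 := by nlinarith [sq_nonneg (y 1), sq_nonneg (y 2)]
    have h2 : y 2 = 0 := by nlinarith [sq_nonneg (y 1), sq_nonneg (y 2)]
    refine ⟨⟨!₂[0, 1], ?_⟩, ?_⟩
    · simp [EuclideanSpace.norm_eq]
    · ext i
      fin_cases i <;> simp [hopfMap, ← h0, h1, h2]
  · set t := √((1 + y 0) / 2) with ht
    have ht2 : t ^ 2 = (1 + y 0) / 2 := Real.sq_sqrt (by linarith)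
    have ht0 : t ≠ 0 := (Real.sqrt_pos.2 (by linarith)).ne'
    have e : (y 1 / (2 * t)) ^ 2 + (y 2 / (2 * t)) ^ 2 = (1 - y 0) / 2 := by
      have : 1 + y 0 ≠ 0 := by linarith
      rw [div_pow, div_pow, mul_pow, ht2]
      field_simp
      linear_combination -h
    refine ⟨⟨!₂[(t : ℂ), ⟨y 1 / (2 * t), -(y 2 / (2 * t))⟩], ?_⟩, ?_⟩
    · rw [mem_sphere_zero_iff_norm, EuclideanSpace.norm_eq, Real.sqrt_eq_one]
      simp only [Fin.sum_univ_two, ← Complex.normSq_eq_norm_sq, Complex.normSq_apply,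
        Matrix.cons_val, Complex.ofReal_re, Complex.ofReal_im]
      linear_combination ht2 + e
    · ext i
      fin_cases i
      · simp only [hopfMap, ← Complex.normSq_eq_norm_sq, Complex.normSq_apply,
          Matrix.cons_val, Complex.ofReal_re, Complex.ofReal_im]
        simp only [Fin.zero_eta, Matrix.cons_val_zero]
        linear_combination ht2 - e
      · simp [hopfMap]
        field_simp
      · simp [hopfMap]
        field_simp

theorem doublingMap_surjective : Function.Surjective doublingMap := by
  rintro ⟨y, hy⟩
  have h := EuclideanSpace.norm_sq_eq y
  rw [mem_sphere_zero_iff_norm.1 hy] at h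
  simp only [Fin.sum_univ_two, Real.norm_eq_abs, sq_abs, one_pow] at h
  have hy0 : -1 ≤ y 0 := by nlinarith [sq_nonneg (y 1)]
  rcases hy0.eq_or_lt with h0 | h0
  · have h1 : y 1 = 0 := by nlinarith [sq_nonneg (y 1)]
    refine ⟨⟨!₂[0, 1], ?_⟩, ?_⟩
    · simp [EuclideanSpace.norm_eq]
    · ext i
      fin_cases i <;> simp [doublingMap, ← h0, h1]
  · set t := √((1 + y 0) / 2) with ht
    have ht2 : t ^ 2 = (1 + y 0) / 2 := Real.sq_sqrt (by linarith)
    have ht0 : t ≠ 0 := (Real.sqrt_pos.2 (by linarith)).ne'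
    have e : (y 1 / (2 * t)) ^ 2 = (1 - y 0) / 2 := by
      have : 1 + y 0 ≠ 0 := by linarith
      rw [div_pow, mul_pow, ht2]
      field_simp
      linear_combination -h
    refine ⟨⟨!₂[t, y 1 / (2 * t)], ?_⟩, ?_⟩
    · rw [mem_sphere_zero_iff_norm, EuclideanSpace.norm_eq, Real.sqrt_eq_one]
      simp only [Fin.sum_univ_two, Real.norm_eq_abs, sq_abs, Matrix.cons_val]
      linear_combination ht2 + e
    · ext i
      fin_cases i
      · simp only [doublingMap, Matrix.cons_val]
        simp only [Fin.zero_eta, Matrix.cons_val_zero]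
        linear_combination ht2 - e
      · simp [doublingMap]
        field_simp

/-- For unit vectors `‖h x + h a‖² = 2 + 2 h x · h a`, so the claim amounts to the identity
`4 |⟪a, x⟫|² = 2 (1 + h x · h a)`. -/
theorem dist_hopfMap_neg (a x : Metric.sphere (0 : EuclideanSpace ℂ (Fin 2)) 1) :
    dist (hopfMap x : EuclideanSpace ℝ (Fin 3)) (-hopfMap a : Metric.sphere _ _) =
      2 * ‖inner ℂ (a : EuclideanSpace ℂ (Fin 2)) (x : EuclideanSpace ℂ (Fin 2))‖ := by
  have hx := norm_sq_add_norm_sq_eq_one ℂ x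
  have ha := norm_sq_add_norm_sq_eq_one ℂ a
  rw [EuclideanSpace.dist_eq, ← Real.sqrt_sq (by positivity :
    0 ≤ 2 * ‖inner ℂ (a : EuclideanSpace ℂ (Fin 2)) (x : EuclideanSpace ℂ (Fin 2))‖), mul_pow,
    ← Complex.normSq_eq_norm_sq]
  congr 1
  simp only [← Complex.normSq_eq_norm_sq, Complex.normSq_apply] at ha hx
  simp [hopfMap, Fin.sum_univ_three, Real.dist_eq, sq_abs, ← Complex.normSq_eq_norm_sq,
    Complex.normSq_apply, PiLp.inner_apply, Fin.sum_univ_two]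
  linear_combination (((x : EuclideanSpace ℂ (Fin 2)) 0).re ^ 2 +
    ((x : EuclideanSpace ℂ (Fin 2)) 0).im ^ 2 + ((x : EuclideanSpace ℂ (Fin 2)) 1).re ^ 2 +
    ((x : EuclideanSpace ℂ (Fin 2)) 1).im ^ 2 - ((a : EuclideanSpace ℂ (Fin 2)) 0).re ^ 2 -
    ((a : EuclideanSpace ℂ (Fin 2)) 0).im ^ 2 - ((a : EuclideanSpace ℂ (Fin 2)) 1).re ^ 2 -
    ((a : EuclideanSpace ℂ (Fin 2)) 1).im ^ 2) * (hx - ha)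

theorem dist_doublingMap_neg (a x : Metric.sphere (0 : EuclideanSpace ℝ (Fin 2)) 1) :
    dist (doublingMap x : EuclideanSpace ℝ (Fin 2)) (-doublingMap a : Metric.sphere _ _) =
      2 * ‖inner ℝ (a : EuclideanSpace ℝ (Fin 2)) (x : EuclideanSpace ℝ (Fin 2))‖ := by
  have hx := norm_sq_add_norm_sq_eq_one ℝ x
  have ha := norm_sq_add_norm_sq_eq_one ℝ a
  rw [EuclideanSpace.dist_eq, ← Real.sqrt_sq (by positivity :
    0 ≤ 2 * ‖inner ℝ (a : EuclideanSpace ℝ (Fin 2)) (x : EuclideanSpace ℝ (Fin 2))‖), mul_pow]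
  congr 1
  simp only [Real.norm_eq_abs, sq_abs] at ha hx
  simp [doublingMap, Real.dist_eq, sq_abs, PiLp.inner_apply, Fin.sum_univ_two]
  linear_combination (((x : EuclideanSpace ℝ (Fin 2)) 0) ^ 2 +
    ((x : EuclideanSpace ℝ (Fin 2)) 1) ^ 2 - ((a : EuclideanSpace ℝ (Fin 2)) 0) ^ 2 -
    ((a : EuclideanSpace ℝ (Fin 2)) 1) ^ 2) * (hx - ha)

theorem neg_comp_surjective {α E : Type*} [NormedAddCommGroup E] {f : α → Metric.sphere (0 : E) 1}
    (hf : f.Surjective) : Function.Surjective fun a => -f a :=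
  neg_surjective.comp hf

/-! ### The Chebyshev constants of the circle -/

/-- Averaging the monic polynomial with the given zeros over a regular polygon leaves its leading
and its constant term, which are aligned by rotating the polygon. -/
theorem exists_two_le_prod_norm_sub {n : ℕ} (hn : 1 ≤ n) (w : Fin n → ℂ) (hw : ∀ j, ‖w j‖ = 1) :
    ∃ z : ℂ, ‖z‖ = 1 ∧ 2 ≤ ∏ j, ‖z - w j‖ := by
  have hn0 : n ≠ 0 := by omega
  let p : Polynomial ℂ := ∏ j, (Polynomial.X - Polynomial.C (w j))
  have hmonic : p.Monic := Polynomial.monic_prod_of_monic _ _ fun j _ => Polynomial.monic_X_sub_C _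
  have hdeg : p.natDegree = n := by simp [p]
  have heval : ∀ z, ‖p.eval z‖ = ∏ j, ‖z - w j‖ := fun z => by
    simp [p, Polynomial.eval_prod, norm_prod]
  have hc : ‖p.coeff 0‖ = 1 := by
    rw [Polynomial.coeff_zero_eq_eval_zero, heval]
    simp [hw]
  -- The rotation `ζ` makes the leading term `ζ ^ n` equal to the constant term.
  obtain ⟨ζ, hζ⟩ := IsAlgClosed.exists_pow_nat_eq (p.coeff 0) (by omega : 0 < n)
  have hζ1 : ‖ζ‖ = 1 := by
    rw [← hζ, norm_pow] at hc
    exact (pow_eq_one_iff_of_nonneg (norm_nonneg _) hn0).1 hc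
  have hprim := Complex.isPrimitiveRoot_exp n hn0
  set ω := Complex.exp (2 * Real.pi * Complex.I / n)
  have hsum : ∑ k ∈ Finset.range n, p.eval (ζ * ω ^ k) = 2 * n * p.coeff 0 := by
    have h1 : ∀ i, ∑ k ∈ Finset.range n, p.coeff i * (ζ * ω ^ k) ^ i =
        p.coeff i * ζ ^ i * ∑ k ∈ Finset.range n, (ω ^ i) ^ k := fun i => by
      rw [Finset.mul_sum]
      refine Finset.sum_congr rfl fun k _ => ?_
      rw [mul_pow, pow_right_comm]
      ring
    have h2 : ∀ i, i ≠ 0 → i < n → ∑ k ∈ Finset.range n, (ω ^ i) ^ k = 0 := fun i hi hin => by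
      rw [geom_sum_eq (hprim.pow_ne_one_of_pos_of_lt hi hin), pow_right_comm, hprim.pow_eq_one]
      simp
    simp only [Polynomial.eval_eq_sum_range, hdeg]
    rw [Finset.sum_comm]
    simp only [h1]
    obtain ⟨l, rfl⟩ := Nat.exists_eq_succ_of_ne_zero hn0
    rw [Finset.sum_range_succ, Finset.sum_range_succ', Finset.sum_eq_zero fun i hi => by
      rw [h2 (i + 1) (by omega) (by simpa using hi), mul_zero]]
    have hlead : p.coeff (l + 1) = 1 := by
      have := hmonic.coeff_natDegree
      rwa [hdeg] at this
    simp only [Nat.succ_eq_add_one] at *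
    rw [hprim.pow_eq_one, hlead, hζ]
    simp
    ring
  have hle : ∑ _k ∈ Finset.range n, (2 : ℝ) ≤ ∑ k ∈ Finset.range n, ‖p.eval (ζ * ω ^ k)‖ := by
    refine le_trans (le_of_eq ?_) (norm_sum_le _ _)
    rw [hsum]
    simp [hc, mul_comm]
  obtain ⟨k, -, hk⟩ := Finset.exists_le_of_sum_le (by simpa using hn0) hle
  refine ⟨ζ * ω ^ k, ?_, by rwa [← heval]⟩
  rw [norm_mul, norm_pow, hζ1, Complex.norm_eq_one_of_pow_eq_one hprim.pow_eq_one hn0]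
  simp

theorem metricChebyshevConst_circle {n : ℕ} (hn : 1 ≤ n) :
    metricChebyshevConst (Metric.sphere (0 : ℂ) 1) n = 2 := by
  have hn0 : n ≠ 0 := by omega
  have hne : Nonempty (Metric.sphere (0 : ℂ) 1) := ⟨⟨1, by simp⟩⟩
  refine le_antisymm ?_ (le_ciInf fun y => ?_)
  · have hprim := Complex.isPrimitiveRoot_exp n hn0
    have hcard : Fintype.card (Polynomial.nthRootsFinset n (1 : ℂ)) = n := by
      simp [hprim.card_nthRootsFinset]
    let e := (Fintype.equivFinOfCardEq hcard).symm
    have he : ∀ j, (e j : ℂ) ∈ Metric.sphere (0 : ℂ) 1 := fun j => by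
      rw [mem_sphere_zero_iff_norm]
      exact Complex.norm_eq_one_of_pow_eq_one
        ((Polynomial.mem_nthRootsFinset hn 1).1 (e j).2) hn0
    refine (ciInf_le ⟨0, ?_⟩ fun j => ⟨e j, he j⟩).trans (ciSup_le fun z => ?_)
    · rintro _ ⟨y, rfl⟩
      exact Real.iSup_nonneg fun z => Finset.prod_nonneg fun _ _ => dist_nonneg
    · have hz : ‖(z : ℂ)‖ = 1 := mem_sphere_zero_iff_norm.1 z.2
      calc ∏ j, dist (z : ℂ) (e j : ℂ)
          = ∏ ω : Polynomial.nthRootsFinset n (1 : ℂ), ‖(z : ℂ) - ω * 1‖ := by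
            rw [← e.prod_comp]; simp [dist_eq_norm]
        _ = ‖(z : ℂ) ^ n - 1 ^ n‖ := by
            rw [Finset.prod_coe_sort (Polynomial.nthRootsFinset n (1 : ℂ))
              fun ω => ‖(z : ℂ) - ω * 1‖, ← norm_prod,
              ← hprim.pow_sub_pow_eq_prod_sub_mul (z : ℂ) 1 hn]
        _ ≤ ‖(z : ℂ) ^ n‖ + ‖(1 : ℂ) ^ n‖ := norm_sub_le _ _
        _ = 2 := by rw [norm_pow, hz]; norm_num
  · obtain ⟨z, hz, h⟩ := exists_two_le_prod_norm_sub hn (fun j => (y j : ℂ)) fun j =>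
      mem_sphere_zero_iff_norm.1 (y j).2
    simp only [← dist_eq_norm] at h
    refine le_ciSup_of_le ⟨2 ^ n, ?_⟩ ⟨z, mem_sphere_zero_iff_norm.2 hz⟩ h
    rintro _ ⟨x, rfl⟩
    have hd : ∀ j, dist (x : ℂ) (y j : ℂ) ≤ 2 := fun j => by
      have := dist_le_norm_add_norm (x : ℂ) (y j : ℂ)
      rw [mem_sphere_zero_iff_norm.1 x.2, mem_sphere_zero_iff_norm.1 (y j).2] at this
      linarith
    exact (Finset.prod_le_prod (fun _ _ => dist_nonneg) fun j _ => hd j).trans (by simp)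

theorem metricChebyshevConst_congr {X Y : Type*} [MetricSpace X] [MetricSpace Y] {F : Set X}
    {G : Set Y} {f : F → G} (hf : f.Surjective)
    (hd : ∀ x y, dist (f x : Y) (f y) = dist (x : X) y) (n : ℕ) :
    metricChebyshevConst G n = metricChebyshevConst F n := by
  have hf' : Function.Surjective fun (a : Fin n → F) j => f (a j) := hf.comp_left
  rw [metricChebyshevConst, ← hf'.iInf_comp, metricChebyshevConst]
  refine iInf_congr fun a => ?_
  rw [← hf.iSup_comp]
  simp [hd]

theorem metricChebyshevConst_sphere_two {n : ℕ} (hn : 1 ≤ n) :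
    metricChebyshevConst (Metric.sphere (0 : EuclideanSpace ℝ (Fin 2)) 1) n = 2 := by
  rw [← metricChebyshevConst_circle hn]
  let e := Complex.orthonormalBasisOneI.repr
  refine metricChebyshevConst_congr
    (f := fun z => ⟨e z, by simp⟩)
    (fun y => ⟨⟨e.symm y, by simp⟩, by simp⟩) (fun x y => e.dist_map _ _) n

/-! ### The polarization constants -/

/-- The two bounds on `infSphereProdSup` differ by the factor `(2 e² m)ᵐ` with `m = ⌊√n⌋`. Since
`m / n ≤ 1 / m`, its `n`-th root is at most `(2 e² m) ^ (1 / m)`, which tends to `1`. -/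
theorem tendsto_polarizationConst_complex :
    HasLinearPolarizationConst ℂ (EuclideanSpace ℂ (Fin 2)) (Real.sqrt (Real.exp 1)) := by
  have hsqrt : Real.sqrt (Real.exp 1) = Real.exp (1 / 2) := by
    rw [Real.sqrt_eq_iff_mul_self_eq (by positivity) (by positivity), ← Real.exp_add]
    norm_num
  rw [HasLinearPolarizationConst, hsqrt]
  have hroot : ∀ n : ℕ, 1 ≤ n → Real.exp (n / 2) ^ (1 / (n : ℝ)) = Real.exp (1 / 2) := by
    intro n hn
    have : (n : ℝ) ≠ 0 := by exact_mod_cast (by omega : n ≠ 0)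
    rw [← Real.exp_mul]
    congr 1
    field_simp
  have hlim : Tendsto (fun m : ℕ => ((2 * Real.exp 2 * m) ^ (1 / (m : ℝ)))) atTop (𝓝 1) := by
    have h1 : Tendsto (fun m : ℕ => (2 * Real.exp 2) ^ (1 / (m : ℝ)) * (m : ℝ) ^ (1 / (m : ℝ)))
        atTop (𝓝 ((2 * Real.exp 2) ^ (0 : ℝ) * 1)) :=
      (tendsto_const_nhds.rpow tendsto_one_div_atTop_nhds_zero_nat (Or.inl (by positivity))).mul
        (tendsto_rpow_div.comp tendsto_natCast_atTop_atTop)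
    rw [Real.rpow_zero, mul_one] at h1
    refine h1.congr fun m => ?_
    rw [← Real.mul_rpow (by positivity) (by positivity)]
  have hsq : Tendsto Nat.sqrt atTop atTop :=
    tendsto_atTop_atTop.2 fun b => ⟨b * b, fun a h => Nat.le_sqrt.2 h⟩
  have hlow : Tendsto (fun n : ℕ => Real.exp (1 / 2) /
      ((2 * Real.exp 2 * (n.sqrt : ℕ)) ^ (1 / ((n.sqrt : ℕ) : ℝ)))) atTop
      (𝓝 (Real.exp (1 / 2))) := by
    have := (tendsto_const_nhds (x := Real.exp (1 / 2))).div (hlim.comp hsq) one_ne_zero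
    rwa [div_one] at this
  refine tendsto_of_tendsto_of_tendsto_of_le_of_le' hlow tendsto_const_nhds ?_ ?_
  · filter_upwards [eventually_ge_atTop 1] with n hn
    have hpos := (Real.exp_pos _).trans_le (exp_neg_half_le_infSphereProdSup n)
    set m := n.sqrt with hm
    have hm1 : 1 ≤ m := Nat.le_sqrt.2 (by simpa using hn)
    have hmm : m * m ≤ n := Nat.sqrt_le n
    have hn2 : n ≤ m * m + 2 * m := by have := Nat.sqrt_le_add n; rw [← hm] at this; omega
    have hm1' : (1 : ℝ) ≤ m := by exact_mod_cast hm1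
    have hn' : (1 : ℝ) ≤ n := by exact_mod_cast hn
    have hmm' : (m : ℝ) * m ≤ n := by exact_mod_cast hmm
    have hbase : 1 ≤ 2 * Real.exp 2 * m := by
      nlinarith [Real.add_one_le_exp (2 : ℝ)]
    have h1 := infSphereProdSup_le_exp n m hm1 hmm hn2
    have h2 : Real.exp (n / 2) / (2 * Real.exp 2 * m) ^ m ≤
        polarizationConst ℂ (EuclideanSpace ℂ (Fin 2)) n := by
      rw [polarizationConst_eq_inv ℂ n hpos]
      refine le_trans (le_of_eq ?_) (inv_anti₀ hpos h1)
      rw [mul_inv, Real.exp_neg, inv_inv]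
      ring
    refine le_trans ?_ (Real.rpow_le_rpow (by positivity) h2 (by positivity))
    rw [Real.div_rpow (by positivity) (by positivity), hroot n hn, ← Real.rpow_natCast,
      ← Real.rpow_mul (by positivity)]
    refine div_le_div_of_nonneg_left (by positivity) (by positivity)
      (Real.rpow_le_rpow_of_exponent_le hbase ?_)
    rw [mul_one_div, div_le_div_iff₀ (by positivity) (by positivity)]
    linarith
  · filter_upwards [eventually_ge_atTop 1] with n hn
    have hle := exp_neg_half_le_infSphereProdSup n
    have hpos := (Real.exp_pos _).trans_le hle
    rw [polarizationConst_eq_inv ℂ n hpos, ← hroot n hn]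
    refine Real.rpow_le_rpow (by positivity) ?_ (by positivity)
    refine (inv_anti₀ (Real.exp_pos _) hle).trans (le_of_eq ?_)
    rw [Real.exp_neg, inv_inv]

theorem polarizationConst_real_eq {n : ℕ} (hn : 1 ≤ n) :
    polarizationConst ℝ (EuclideanSpace ℝ (Fin 2)) n
        = 2 ^ n / metricChebyshevConst (Metric.sphere (0 : EuclideanSpace ℝ (Fin 2)) 1) n ∧
      polarizationConst ℝ (EuclideanSpace ℝ (Fin 2)) n = 2 ^ (n - 1) := by
  have hd := fun a x => dist_doublingMap_neg a x
  have hs := neg_comp_surjective doublingMap_surjective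
  have hM := metricChebyshevConst_eq ℝ hs doublingMap_surjective hd n
  rw [metricChebyshevConst_sphere_two hn] at hM
  have hpos : 0 < infSphereProdSup ℝ (EuclideanSpace ℝ (Fin 2)) n :=
    pos_of_mul_pos_right (hM ▸ two_pos) (by positivity)
  have h := polarizationConst_eq_div ℝ hs doublingMap_surjective hd n hpos
  refine ⟨h, ?_⟩
  rw [h, metricChebyshevConst_sphere_two hn, div_eq_iff two_ne_zero, ← pow_succ,
    Nat.sub_add_cancel hn]

theorem tendsto_polarizationConst_real :
    HasLinearPolarizationConst ℝ (EuclideanSpace ℝ (Fin 2)) 2 := by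
  have h : Tendsto (fun n : ℕ => (2 : ℝ) * (2 : ℝ) ^ (-(1 / (n : ℝ)))) atTop
      (𝓝 (2 * 2 ^ (-(0 : ℝ)))) :=
    tendsto_const_nhds.mul (tendsto_const_nhds.rpow tendsto_one_div_atTop_nhds_zero_nat.neg
      (Or.inl two_ne_zero))
  rw [neg_zero, Real.rpow_zero, mul_one] at h
  refine h.congr' ?_
  filter_upwards [eventually_ge_atTop 1] with n hn
  have hn0 : (n : ℝ) ≠ 0 := by exact_mod_cast (by omega : n ≠ 0)
  rw [(polarizationConst_real_eq hn).2, ← Real.rpow_natCast, ← Real.rpow_mul two_pos.le,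
    Nat.cast_sub hn]
  nth_rw 1 [← Real.rpow_one 2]
  rw [← Real.rpow_add two_pos]
  congr 1
  push_cast
  field_simp
  ring

theorem mainTheorem3 :
    (∀ n : ℕ, 1 ≤ n →
      polarizationConst ℝ (EuclideanSpace ℝ (Fin 2)) n
          = 2 ^ n / metricChebyshevConst (Metric.sphere (0 : EuclideanSpace ℝ (Fin 2)) 1) n ∧
      polarizationConst ℝ (EuclideanSpace ℝ (Fin 2)) n = 2 ^ (n - 1)) ∧
    HasLinearPolarizationConst ℝ (EuclideanSpace ℝ (Fin 2)) 2 ∧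
    (∀ n : ℕ, 1 ≤ n →
      polarizationConst ℂ (EuclideanSpace ℂ (Fin 2)) n
          = 2 ^ n / metricChebyshevConst (Metric.sphere (0 : EuclideanSpace ℝ (Fin 3)) 1) n) ∧
    HasLinearPolarizationConst ℂ (EuclideanSpace ℂ (Fin 2)) (Real.sqrt (Real.exp 1)) :=
  ⟨fun _ hn => polarizationConst_real_eq hn, tendsto_polarizationConst_real,
    fun n _ => polarizationConst_eq_div ℂ (neg_comp_surjective hopfMap_surjective)
      hopfMap_surjective (fun a x => dist_hopfMap_neg a x) n
      ((Real.exp_pos _).trans_le (exp_neg_half_le_infSphereProdSup n)),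
    tendsto_polarizationConst_complex⟩
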